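/- Let $(R,\mathfrak m,k)$ be a commutative noetherian local ring. An ideal $I$ of a local ring $(S,\mathfrak n)$ is called a \emph{Burch ideal} if $\mathfrak n I\neq\mathfrak n(I:_S\mathfrak n)$. A noetherian local ring $R$ of depth $t$, with $\mathfrak m$-adic completion $\widehat R$, is called a \emph{Burch ring} if there exist a maximal $\widehat R$-regular sequence $x_1,\dots,x_t$ in $\widehat R$, a regular local ring $S$, and a Burch ideal $I$ of $S$ such that $\widehat R/(x_1,\dots,x_t)\cong S/I$. Suppose that $R$ is a Burch ring of depth zero that is not a field. Let $M$ be a finitely generated $R$-module, and let $$\cdots\to F_2\xrightarrow{\partial_2}F_1\xrightarrow{\partial_1}F_0\to M\to 0$$ be a minimal free resolution of $M$, that is, an exact sequence with all $F_i$ finitely generated free and $\operatorname{Im}\partial_i\subseteq\mathfrak mF_{i-1}$ for all $i>0$. For $i>0$ let $\operatorname{I}_1(\partial_i)$ be the ideal of $R$ generated by the entries of a matrix representing $\partial_i$, and for $r>0$ let $\Omega^r_RM=\operatorname{Im}\partial_r$ be the $r$th syzygy of $M$. Then the following are equivalent. (1) $\sum_{i>0}\operatorname{I}_1(\partial_i)=\mathfrak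 m$. (2) $k$ is isomorphic to a direct summand of $\Omega^r_RM$ for some $r\ge 2$. Moreover, if $\sum_{i>0}\operatorname{I}_1(\partial_i)=\mathfrak m$, then there exists an integer $i\ge 3$ such that $\operatorname{I}_1(\partial_i)=\mathfrak m$. -/

import Mathlib

universe u v w

namespace Burch

open IsLocalRing

/-- An ideal `I` of a local ring `(S, 𝔫)` is a Burch ideal if `𝔫 I ≠ 𝔫 (I : 𝔫)`. -/
def IsBurchIdeal {S : Type u} [CommRing S] [IsLocalRing S] (I : Ideal S) : Prop :=
  maximalIdeal S * I ≠ maximalIdeal S * Submodule.colon I (maximalIdeal S : Set S)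

/-- The depth of a (noetherian) local ring: the supremum of the lengths of its regular sequences.
Such sequences lie in the maximal ideal, since `RingTheory.Sequence.IsRegular R xs` includes
`(xs) ≠ R`. -/
noncomputable def depth (R : Type u) [CommRing R] : ℕ∞ :=
  ⨆ (xs : List R) (_ : RingTheory.Sequence.IsRegular R xs), (xs.length : ℕ∞)

/-- `xs` is a maximal regular sequence of the local ring `R`. -/
def IsMaximalRegular {R : Type u} [CommRing R] (xs : List R) : Prop :=
  RingTheory.Sequence.IsRegular R xs ∧
    ∀ y : R, ¬ RingTheory.Sequence.IsRegular R (xs ++ [y])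

/-- A local ring `R` of depth `t` is Burch if there are a maximal regular sequence `x₁, …, x_t` of
its completion, a regular local ring `S` and a Burch ideal `I` of `S` such that
`R̂ / (x₁, …, x_t) ≅ S / I`. -/
def IsBurchRing (R : Type u) [CommRing R] [IsLocalRing R] : Prop :=
  ∃ xs : List (AdicCompletion (maximalIdeal R) R),
    (xs.length : ℕ∞) = depth R ∧ IsMaximalRegular xs ∧
    ∃ (S : Type u) (_ : CommRing S) (_ : IsRegularLocalRing S) (I : Ideal S),
      IsBurchIdeal I ∧
      Nonempty ((AdicCompletion (maximalIdeal R) R ⧸ Ideal.ofList xs) ≃+* (S ⧸ I))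

section Resolutions

variable {R : Type u} [CommRing R]

/-- `I₁(f)`, for a homomorphism `f` of finite free modules: the ideal generated by the entries of
the matrix of `f` with respect to (some) bases of `F` and `G`. See `entryIdeal_eq` for the
independence of the bases. -/
noncomputable def entryIdeal {F : Type v} {G : Type w} [AddCommGroup F] [Module R F]
    [Module.Free R F] [Module.Finite R F] [AddCommGroup G] [Module R G] [Module.Free R G]
    [Module.Finite R G] (f : F →ₗ[R] G) : Ideal R :=
  open Classical in
  Ideal.span {a : R | ∃ i j, a =
    LinearMap.toMatrix (Module.Free.chooseBasis R F) (Module.Free.chooseBasis R G) f i j}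

theorem span_toMatrix_eq {F : Type v} {G : Type w} [AddCommGroup F] [Module R F]
    [AddCommGroup G] [Module R G] {ι κ : Type*} [Fintype ι] [DecidableEq ι] [Finite κ]
    (b : Module.Basis ι R F) (c : Module.Basis κ R G) (f : F →ₗ[R] G) :
    Ideal.span {a : R | ∃ i j, a = LinearMap.toMatrix b c f i j} =
      Ideal.span {a : R | ∃ (φ : G →ₗ[R] R) (x : F), a = φ (f x)} := by
  have := Fintype.ofFinite κ
  apply le_antisymm
  · rw [Ideal.span_le]
    rintro a ⟨i, j, rfl⟩
    exact Ideal.subset_span ⟨c.coord i, b j, by simp [LinearMap.toMatrix_apply]⟩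
  · rw [Ideal.span_le]
    rintro a ⟨φ, x, rfl⟩
    rw [SetLike.mem_coe, ← b.sum_repr x, map_sum, map_sum]
    refine Ideal.sum_mem _ fun j _ => ?_
    rw [map_smul, map_smul, smul_eq_mul]
    refine Ideal.mul_mem_left _ _ ?_
    rw [← c.sum_repr (f (b j)), map_sum]
    refine Ideal.sum_mem _ fun i _ => ?_
    rw [map_smul, smul_eq_mul]
    exact Ideal.mul_mem_right _ _
      (Ideal.subset_span ⟨i, j, by simp [LinearMap.toMatrix_apply]⟩)

/-- `I₁(f)` is the ideal generated by the entries of the matrix of `f` in any bases. -/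
theorem entryIdeal_eq {F : Type v} {G : Type w} [AddCommGroup F] [Module R F]
    [Module.Free R F] [Module.Finite R F] [AddCommGroup G] [Module R G] [Module.Free R G]
    [Module.Finite R G] {ι κ : Type*} [Fintype ι] [DecidableEq ι] [Finite κ]
    (b : Module.Basis ι R F) (c : Module.Basis κ R G) (f : F →ₗ[R] G) :
    entryIdeal f = Ideal.span {a : R | ∃ i j, a = LinearMap.toMatrix b c f i j} := by
  classical
  rw [entryIdeal, span_toMatrix_eq, span_toMatrix_eq]

/-- `⋯ → F 2 → F 1 → F 0 → M → 0` is a minimal free resolution of `M` over the local ring `R`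
(the modules `F i` being finite free). Here `d i : F (i + 1) → F i` is the differential usually
called `∂_{i+1}`, and `ε : F 0 → M` is the augmentation. -/
structure IsMinimalFreeResolution [IsLocalRing R] {M : Type v} [AddCommGroup M] [Module R M]
    {F : ℕ → Type w} [∀ i, AddCommGroup (F i)] [∀ i, Module R (F i)]
    [∀ i, Module.Free R (F i)] [∀ i, Module.Finite R (F i)]
    (d : ∀ i, F (i + 1) →ₗ[R] F i) (ε : F 0 →ₗ[R] M) : Prop where
  surjective : Function.Surjective ε
  exact_zero : Function.Exact (d 0) ε
  exact_succ : ∀ i, Function.Exact (d (i + 1)) (d i)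
  minimal : ∀ i, LinearMap.range (d i) ≤ maximalIdeal R • (⊤ : Submodule R (F i))

/-- `X` is isomorphic to a direct summand of `N`. -/
def IsDirectSummand (R : Type u) [CommRing R] (X : Type v) [AddCommGroup X] [Module R X]
    (N : Type w) [AddCommGroup N] [Module R N] : Prop :=
  ∃ A B : Submodule R N, IsCompl A B ∧ Nonempty (X ≃ₗ[R] A)

end Resolutions

end Burch

/-!
The residue field `k` is a direct summand of a finitely generated module `N` exactly when some
socle element of `N` lies outside `𝔪 N`.

If `k` is a summand of the syzygy `im ∂_r`, then a basis vector of `F r` maps to a generator of that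
summand, its multiples by `𝔪` lie in `ker ∂_r = im ∂_{r+1}`, and therefore `I₁(∂_{r+1}) = 𝔪`
(`Burch.entryIdeal_eq_of_isDirectSummand`). With `r ≥ 2` this gives both the implication from
summands to `∑ I₁(∂_i) = 𝔪` and the last assertion.

For the remaining implication write the completion as `S ⧸ I` with `(S, 𝔫)` local and `I` Burch, so
that `x g ∉ 𝔫 I` for some `x ∈ 𝔫` and `g ∈ (I : 𝔫)`. By flatness of the completion, `g` can be chosen
to lift a socle element `σ` of `R` (`Burch.exists_socle_lift`). Suppose that no syzygy from the
second on has `k` as a summand. Then `σ F j ⊆ 𝔪 ker ∂_j` for all `j ≥ 1`. Write `σ e = ∑ aₗ vₗ` with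
`aₗ ∈ 𝔪` and `vₗ ∈ ker ∂_j`, lift everything to `S`, and apply a lift of `∂_j`: the values at lifts of
`vₗ` lie in `I`, the entries of the lift lie in `𝔫`, and so `g ∂_j(e) ∈ 𝔫 I`
(`Burch.exists_lift_mul_mem`). Thus `g` multiplies lifts of all the entries into `𝔫 I`; as the
entries generate `𝔪`, it multiplies `𝔫` into `𝔫 I`, against `x g ∉ 𝔫 I`.
-/

namespace Burch

open IsLocalRing

/-! ### Summands isomorphic to the residue field -/

section Summands

variable {R : Type u} [CommRing R]

theorem entryIdeal_eq_span {F : Type v} {G : Type w} [AddCommGroup F] [Module R F]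
    [Module.Free R F] [Module.Finite R F] [AddCommGroup G] [Module R G] [Module.Free R G]
    [Module.Finite R G] (f : F →ₗ[R] G) :
    entryIdeal f = Ideal.span {a : R | ∃ (φ : G →ₗ[R] R) (x : F), a = φ (f x)} := by
  classical
  rw [entryIdeal, span_toMatrix_eq]

theorem map_mem_of_mem_smul_top {G : Type w} [AddCommGroup G] [Module R G] {J : Ideal R} {y : G}
    (hy : y ∈ J • (⊤ : Submodule R G)) (φ : G →ₗ[R] R) : φ y ∈ J := by
  refine Submodule.smul_induction_on hy (fun r hr v _ => ?_) fun v w hv hw => ?_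
  · rw [map_smul, smul_eq_mul]
    exact J.mul_mem_right _ hr
  · rw [map_add]
    exact J.add_mem hv hw

variable [IsLocalRing R]

theorem entryIdeal_le {F : Type v} {G : Type w} [AddCommGroup F] [Module R F]
    [Module.Free R F] [Module.Finite R F] [AddCommGroup G] [Module R G] [Module.Free R G]
    [Module.Finite R G] {f : F →ₗ[R] G}
    (hf : LinearMap.range f ≤ maximalIdeal R • (⊤ : Submodule R G)) :
    entryIdeal f ≤ maximalIdeal R := by
  rw [entryIdeal_eq_span, Ideal.span_le]
  rintro a ⟨φ, x, rfl⟩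
  exact map_mem_of_mem_smul_top (hf ⟨x, rfl⟩) φ

/-- A vector of a free module that is nonzero modulo `𝔪` has a unit coordinate. -/
theorem exists_functional_eq_one {F : Type v} [AddCommGroup F] [Module R F] [Module.Free R F]
    {e : F} (he : e ∉ maximalIdeal R • (⊤ : Submodule R F)) : ∃ φ : F →ₗ[R] R, φ e = 1 := by
  let b := Module.Free.chooseBasis R F
  by_contra! h
  refine he ?_
  rw [← b.linearCombination_repr e, Finsupp.linearCombination_apply]
  refine Submodule.sum_mem _ fun i _ => Submodule.smul_mem_smul ?_ trivial
  rw [mem_maximalIdeal, mem_nonunits_iff]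
  rintro ⟨u, hu⟩
  refine h ((↑u⁻¹ : R) • b.coord i) ?_
  simp [← hu]

/-- If `k` is a summand of the image of `f`, then `I₁` of the next differential is `𝔪`. -/
theorem entryIdeal_eq_of_isDirectSummand {E : Type*} {F : Type*} {G : Type*}
    [AddCommGroup E] [Module R E] [Module.Free R E] [Module.Finite R E]
    [AddCommGroup F] [Module R F] [Module.Free R F] [Module.Finite R F]
    [AddCommGroup G] [Module R G]
    {g : E →ₗ[R] F} {f : F →ₗ[R] G} (hgf : Function.Exact g f)
    (hg : LinearMap.range g ≤ maximalIdeal R • (⊤ : Submodule R F))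
    (h : IsDirectSummand R (ResidueField R) (LinearMap.range f)) :
    entryIdeal g = maximalIdeal R := by
  refine (entryIdeal_le hg).antisymm fun r hr => ?_
  obtain ⟨A, B, hAB, ⟨q⟩⟩ := h
  let p : F →ₗ[R] ResidueField R :=
    q.symm.toLinearMap ∘ₗ A.projectionOnto B hAB ∘ₗ f.rangeRestrict
  obtain ⟨e, he⟩ := f.surjective_rangeRestrict (q 1)
  have hpe : p e = 1 := by simp [p, he]
  have hsmul : ∀ s ∈ maximalIdeal R, ∀ c : ResidueField R, s • c = 0 := fun s hs c => by
    rw [Algebra.smul_def, ResidueField.algebraMap_eq, (residue_eq_zero_iff s).2 hs, zero_mul]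
  have he' : e ∉ maximalIdeal R • (⊤ : Submodule R F) := fun hmem => by
    have hle : maximalIdeal R • (⊤ : Submodule R F) ≤ LinearMap.ker p :=
      Submodule.smul_le.2 fun s hs y _ => by
        rw [LinearMap.mem_ker, map_smul, hsmul s hs]
    exact one_ne_zero (hpe.symm.trans (hle hmem))
  obtain ⟨φ, hφ⟩ := exists_functional_eq_one he'
  have hre : f (r • e) = 0 := by
    have h0 : r • q 1 = 0 := by rw [← map_smul, hsmul r hr, map_zero]
    have h1 : f.rangeRestrict (r • e) = 0 := by
      rw [map_smul, he, ← Submodule.coe_smul, h0, Submodule.coe_zero]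
    exact congrArg Subtype.val h1
  obtain ⟨x, hx⟩ := (hgf _).1 hre
  rw [entryIdeal_eq_span]
  exact Ideal.subset_span ⟨φ, x, by rw [hx, map_smul, hφ, smul_eq_mul, mul_one]⟩

/-- A socle element outside `𝔪 N` spans a direct summand isomorphic to `k`. -/
theorem isDirectSummand_of_socle {N : Type*} [AddCommGroup N] [Module R N] {z : N}
    (hz : ∀ r ∈ maximalIdeal R, r • z = 0) (hzm : z ∉ maximalIdeal R • (⊤ : Submodule R N)) :
    IsDirectSummand R (ResidueField R) N := by
  let Q := N ⧸ maximalIdeal R • (⊤ : Submodule R N)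
  let _ : Field (R ⧸ maximalIdeal R) := Ideal.Quotient.field _
  have hQ : (Submodule.Quotient.mk z : Q) ≠ 0 := by
    rwa [Ne, Submodule.Quotient.mk_eq_zero]
  obtain ⟨f, hf⟩ := Module.Projective.exists_dual_eq_one (R ⧸ maximalIdeal R) hQ
  let p : N →ₗ[R] R ⧸ maximalIdeal R := f.restrictScalars R ∘ₗ Submodule.mkQ _
  have hp : ∀ r : R, p (r • z) = Ideal.Quotient.mk _ r := fun r => by
    have : p z = 1 := hf
    rw [map_smul, this, Algebra.smul_def, mul_one]
    rfl
  have hker : ∀ r : R, r • z = 0 ↔ r ∈ maximalIdeal R := fun r =>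
    ⟨fun h => by rw [← Ideal.Quotient.eq_zero_iff_mem, ← hp, h, map_zero], hz r⟩
  refine ⟨R ∙ z, LinearMap.ker p, ⟨?_, ?_⟩, ⟨?_⟩⟩
  · rw [Submodule.disjoint_def]
    intro y hy hy'
    obtain ⟨r, rfl⟩ := Submodule.mem_span_singleton.1 hy
    rw [LinearMap.mem_ker, hp, Ideal.Quotient.eq_zero_iff_mem] at hy'
    exact hz r hy'
  · rw [codisjoint_iff, eq_top_iff]
    rintro y -
    obtain ⟨r, hr⟩ := Ideal.Quotient.mk_surjective (p y)
    refine Submodule.mem_sup.2 ⟨r • z, Submodule.mem_span_singleton.2 ⟨r, rfl⟩, y - r • z, ?_,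
      add_sub_cancel _ _⟩
    rw [LinearMap.mem_ker, map_sub, hp, hr, sub_self]
  · have hk : LinearMap.ker (LinearMap.toSpanSingleton R N z) = maximalIdeal R := by
      ext r
      simpa using hker r
    exact (Submodule.quotEquivOfEq _ _ hk.symm).trans
      ((LinearMap.quotKerEquivRange _).trans
        (LinearEquiv.ofEq _ _ (LinearMap.range_toSpanSingleton z)))

end Summands

/-! ### Lifting along a presentation of a flat algebra -/

section Lifting

variable {R A S : Type*} [CommRing R] [IsLocalRing R] [CommRing A] [Algebra R A]
  [CommRing S] [IsLocalRing S] {π : S →+* A}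

/-- An element of a presentation `π : S → A` of a flat `R`-algebra whose image in `A` is killed by
`𝔪` may be traded for a lift of a socle element of `R`: the image is an `A`-linear combination of
such elements. -/
theorem exists_socle_lift [IsNoetherianRing R] [Module.Flat R A] (hπ : Function.Surjective π)
    (hm : ∀ r ∈ maximalIdeal R, ∀ s, π s = algebraMap R A r → s ∈ maximalIdeal S)
    (hI : IsBurchIdeal (RingHom.ker π)) :
    ∃ (σ : R) (x g : S), (∀ r ∈ maximalIdeal R, r * σ = 0) ∧ π g = algebraMap R A σ ∧
      x ∈ maximalIdeal S ∧ x * g ∉ maximalIdeal S * RingHom.ker π := by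
  set I := RingHom.ker π
  -- The inclusion `𝔫 I ≤ 𝔫 (I : 𝔫)` always holds, so the opposite one fails.
  have hle : ¬ maximalIdeal S * Submodule.colon I (maximalIdeal S : Set S) ≤
      maximalIdeal S * I := fun h =>
    hI (le_antisymm (Ideal.mul_mono_right Ideal.le_colon) h)
  rw [Ideal.mul_le] at hle
  push Not at hle
  obtain ⟨x, hx, g, hg, hxg⟩ := hle
  let X : R →ₗ[R] A := LinearMap.toSpanSingleton R A (π g)
  have hX : X ∘ₗ (maximalIdeal R).subtype = 0 := by
    ext ⟨r, hr⟩
    obtain ⟨s, hs⟩ := hπ (algebraMap R A r)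
    have hgs : π (g * s) = 0 :=
      Submodule.mem_colon.1 hg s (hm r hr s hs)
    simpa [X, Algebra.smul_def, ← hs, mul_comm] using hgs
  obtain ⟨k, a, y, hya, ha⟩ := Module.Flat.exists_factorization_of_comp_eq_zero_of_free hX
  have hsoc : ∀ i, ∀ r ∈ maximalIdeal R, r * a 1 i = 0 := fun i r hr => by
    have h := LinearMap.congr_fun ha ⟨r, hr⟩
    have h' : a (r • 1) = 0 := by simpa using h
    rw [map_smul] at h'
    simpa using DFunLike.congr_fun h' i
  by_contra! hcon
  -- With `π g = ∑ yᵢ aᵢ`, lifts `tᵢ` of `yᵢ` and `cᵢ` of `aᵢ` give `g - ∑ tᵢ cᵢ ∈ I`.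
  choose c hc using fun i => hπ (algebraMap R A (a 1 i))
  choose t ht using fun i => hπ (y (Finsupp.single i 1))
  have hsum : g - ∑ i, t i * c i ∈ I := by
    have h1 : π g = y (a 1) := by
      simpa [X] using LinearMap.congr_fun hya 1
    have h2 : a 1 = ∑ i, a 1 i • Finsupp.single i (1 : R) := by
      ext j
      simp
    rw [RingHom.mem_ker, map_sub, h1, sub_eq_zero]
    conv_lhs => rw [h2]
    simp only [map_sum, map_smul, map_mul, hc, ht, Algebra.smul_def, mul_comm]
  refine hxg ?_
  have heq : x * g = x * (g - ∑ i, t i * c i) + ∑ i, t i * (x * c i) := by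
    rw [mul_sub, Finset.mul_sum]
    simp only [mul_left_comm, sub_add_cancel]
  rw [heq]
  exact add_mem (Ideal.mul_mem_mul hx hsum)
    (Ideal.sum_mem _ fun i _ => Ideal.mul_mem_left _ _ (hcon _ _ _ (hsoc i) (hc i) hx))

/-- Let `ψ` be a functional on a free module that takes values in `𝔪` and vanishes on `K`. If
`σ F ⊆ 𝔪 K`, then any lift `g` of `σ` multiplies a lift of each value of `ψ` into `𝔫 I`. -/
theorem exists_lift_mul_mem (hπ : Function.Surjective π)
    (hm : ∀ r ∈ maximalIdeal R, ∀ s, π s = algebraMap R A r → s ∈ maximalIdeal S)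
    {σ : R} {g : S} (hg : π g = algebraMap R A σ)
    {F : Type*} [AddCommGroup F] [Module R F] [Module.Free R F] [Module.Finite R F]
    {ψ : F →ₗ[R] R} {K : Submodule R F} (hK : K ≤ LinearMap.ker ψ)
    (hψ : ∀ y, ψ y ∈ maximalIdeal R) {y : F} (hy : σ • y ∈ maximalIdeal R • K) :
    ∃ s, π s = algebraMap R A (ψ y) ∧ s * g ∈ maximalIdeal S * RingHom.ker π := by
  let b := Module.Free.chooseBasis R F
  choose θ hθ using fun r : R => hπ (algebraMap R A r)
  let Ψ : (Module.Free.ChooseBasisIndex R F → S) →ₗ[S] S :=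
    Fintype.linearCombination S (fun i => θ (ψ (b i)))
  have hΨ : ∀ w, Ψ w = ∑ i, w i * θ (ψ (b i)) := fun w => by
    simp [Ψ, Fintype.linearCombination_apply]
  have hπΨ : ∀ (w : _ → S) (v : F), (∀ i, π (w i) = algebraMap R A (b.repr v i)) →
      π (Ψ w) = algebraMap R A (ψ v) := fun w v h => by
    conv_rhs => rw [← b.sum_repr v]
    simp only [hΨ, map_sum, map_mul, map_smul, smul_eq_mul, h, hθ]
  have key : ∀ z ∈ maximalIdeal R • K, ∃ w : _ → S,
      (∀ i, π (w i) = algebraMap R A (b.repr z i)) ∧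
        Ψ w ∈ maximalIdeal S * RingHom.ker π := fun z hz => by
    refine Submodule.smul_induction_on hz (fun r hr v hv => ?_) fun z₁ z₂ h₁ h₂ => ?_
    · refine ⟨θ r • fun i => θ (b.repr v i), fun i => by simp [hθ], ?_⟩
      rw [map_smul, smul_eq_mul]
      refine Ideal.mul_mem_mul (hm r hr _ (hθ r)) ?_
      rw [RingHom.mem_ker, hπΨ _ v fun i => hθ _, LinearMap.mem_ker.1 (hK hv), map_zero]
    · obtain ⟨w₁, h₁, h₁'⟩ := h₁
      obtain ⟨w₂, h₂, h₂'⟩ := h₂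
      exact ⟨w₁ + w₂, fun i => by simp [h₁, h₂], by rw [map_add]; exact add_mem h₁' h₂'⟩
  obtain ⟨w, hw, hw'⟩ := key _ hy
  let u : Module.Free.ChooseBasisIndex R F → S := fun i => θ (b.repr y i)
  refine ⟨Ψ u, hπΨ _ _ fun i => hθ _, ?_⟩
  -- `w` and `g • u` both lift `σ • y`, so they differ by a vector with coordinates in `I`.
  have hdiff : Ψ (g • u - w) ∈ maximalIdeal S * RingHom.ker π := by
    rw [hΨ]
    refine Ideal.sum_mem _ fun i _ => ?_
    rw [mul_comm ((g • u - w) i)]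
    refine Ideal.mul_mem_mul (hm _ (hψ _) _ (hθ _)) ?_
    simp [RingHom.mem_ker, hw, u, hg, hθ]
  have h := add_mem hdiff hw'
  rwa [← map_add, sub_add_cancel, map_smul, smul_eq_mul, mul_comm g] at h

end Lifting

/-! ### Burch rings of depth zero -/

/-- A Burch ring of depth zero has a completion of the form `S ⧸ I` with `I` a Burch ideal. -/
theorem IsBurchRing.exists_presentation {R : Type u} [CommRing R] [IsLocalRing R]
    (h : IsBurchRing R) (hdepth : depth R = 0) :
    ∃ (S : Type u) (_ : CommRing S) (_ : IsLocalRing S)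
      (π : S →+* AdicCompletion (maximalIdeal R) R),
      Function.Surjective π ∧ IsBurchIdeal (RingHom.ker π) := by
  obtain ⟨xs, hlen, -, S, _, _, I, hI, ⟨e⟩⟩ := h
  obtain rfl : xs = [] := by
    rw [hdepth] at hlen
    exact List.length_eq_zero_iff.1 (by exact_mod_cast hlen)
  let e' : S ⧸ I ≃+* AdicCompletion (maximalIdeal R) R :=
    e.symm.trans ((Ideal.quotEquivOfEq (Ideal.ofList_nil)).trans (RingEquiv.quotientBot _))
  refine ⟨S, _, inferInstance, e'.toRingHom.comp (Ideal.Quotient.mk I),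
    e'.surjective.comp Ideal.Quotient.mk_surjective, ?_⟩
  have hk : RingHom.ker (e'.toRingHom.comp (Ideal.Quotient.mk I)) = I := by
    ext s
    simp [RingHom.mem_ker, Ideal.Quotient.eq_zero_iff_mem]
  rwa [hk]

/-- Over a Burch ring of depth zero some socle element `σ` of the ring detects `k`-summands: a
family of functionals with values in `𝔪`, each vanishing on a submodule `K i` with `σ F ⊆ 𝔪 K i`,
cannot have values that generate `𝔪`. -/
theorem IsBurchRing.exists_socle_element {R : Type u} [CommRing R] [IsLocalRing R]
    [IsNoetherianRing R] (h : IsBurchRing R) (hdepth : depth R = 0) (hfield : ¬ IsField R) :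
    ∃ σ : R, (∀ r ∈ maximalIdeal R, r * σ = 0) ∧ ∃ J : Ideal R, ¬ maximalIdeal R ≤ J ∧
      ∀ {F : Type w} [AddCommGroup F] [Module R F] [Module.Free R F] [Module.Finite R F]
        (ψ : F →ₗ[R] R) (K : Submodule R F), K ≤ LinearMap.ker ψ →
        (∀ y, ψ y ∈ maximalIdeal R) → (∀ y : F, σ • y ∈ maximalIdeal R • K) →
        ∀ y, ψ y ∈ J := by
  obtain ⟨S, _, _, π, hπ, hI⟩ := h.exists_presentation hdepth
  let A := AdicCompletion (maximalIdeal R) R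
  have hm : ∀ r ∈ maximalIdeal R, ∀ s, π s = algebraMap R A r → s ∈ maximalIdeal S :=
    fun r hr s hs => by
      rw [mem_maximalIdeal, mem_nonunits_iff]
      intro hu
      exact (mem_maximalIdeal r).1 hr (isUnit_of_map_unit (algebraMap R A) r (hs ▸ hu.map π))
  obtain ⟨σ, x, g, hσ, hg, hx, hxg⟩ := exists_socle_lift hπ hm hI
  have hσm : σ ∈ maximalIdeal R := by
    rw [mem_maximalIdeal, mem_nonunits_iff]
    intro hu
    refine hfield (isField_iff_maximalIdeal_eq.2 (le_bot_iff.1 fun r hr => ?_))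
    exact (hu.mul_left_eq_zero).1 (hσ r hr)
  let J' : Ideal S := Submodule.colon (maximalIdeal S * RingHom.ker π) {g}
  refine ⟨σ, hσ, (J'.map π).comap (algebraMap R A), fun hle => hxg ?_, ?_⟩
  -- If `𝔪 ≤ J`, then `π x` is the image of some `s` with `s g ∈ 𝔫 I`, and `x - s ∈ I`.
  · rw [← Ideal.map_le_iff_le_comap, ← AdicCompletion.maximalIdeal_eq_map] at hle
    have hπx : π x ∈ maximalIdeal A := by
      have := hπ.isLocalHom
      exact ((mem_maximalIdeal _).2 fun hu => (mem_maximalIdeal x).1 hx (isUnit_of_map_unit π x hu))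
    obtain ⟨s, hs, hsx⟩ := (Ideal.mem_map_iff_of_surjective π hπ).1 (hle hπx)
    have h1 : s * g ∈ maximalIdeal S * RingHom.ker π := Submodule.mem_colon_singleton.1 hs
    have h2 : g * (x - s) ∈ maximalIdeal S * RingHom.ker π :=
      Ideal.mul_mem_mul (hm σ hσm g hg) (by rw [RingHom.mem_ker, map_sub, hsx, sub_self])
    have h3 := add_mem h1 h2
    rwa [show s * g + g * (x - s) = x * g by ring] at h3
  · intro F _ _ _ _ ψ K hK hψ hy y
    obtain ⟨s, hs, hsg⟩ := exists_lift_mul_mem hπ hm hg hK hψ (hy y)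
    rw [Ideal.mem_comap, ← hs]
    exact Ideal.mem_map_of_mem π (Submodule.mem_colon_singleton.2 hsg)

/-- If the entries of all the differentials together generate `𝔪`, then `k` is a summand of some
syzygy from the second on. -/
theorem IsMinimalFreeResolution.exists_isDirectSummand {R : Type u} [CommRing R] [IsLocalRing R]
    [IsNoetherianRing R] (hBurch : IsBurchRing R) (hdepth : depth R = 0) (hfield : ¬ IsField R)
    {M : Type v} [AddCommGroup M] [Module R M]
    {F : ℕ → Type w} [∀ i, AddCommGroup (F i)] [∀ i, Module R (F i)]
    [∀ i, Module.Free R (F i)] [∀ i, Module.Finite R (F i)]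
    {d : ∀ i, F (i + 1) →ₗ[R] F i} {ε : F 0 →ₗ[R] M} (hF : IsMinimalFreeResolution d ε)
    (h : (⨆ i, entryIdeal (d i)) = maximalIdeal R) :
    ∃ i, IsDirectSummand R (ResidueField R) (LinearMap.range (d (i + 1))) := by
  obtain ⟨σ, hσ, J, hJ, hmem⟩ := hBurch.exists_socle_element hdepth hfield
  obtain ⟨i, hi⟩ : ∃ i, ∃ y : F (i + 1),
      σ • y ∉ maximalIdeal R • LinearMap.ker (d i) := by
    by_contra! hcon
    refine hJ (h ▸ iSup_le fun i => ?_)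
    rw [entryIdeal_eq_span, Ideal.span_le]
    rintro _ ⟨φ, y, rfl⟩
    exact hmem (φ ∘ₗ d i) (LinearMap.ker (d i)) (LinearMap.ker_le_ker_comp _ _)
      (fun y => map_mem_of_mem_smul_top (hF.minimal i ⟨y, rfl⟩) φ) (hcon i) y
  obtain ⟨y, hy⟩ := hi
  have hker : LinearMap.range (d (i + 1)) = LinearMap.ker (d i) :=
    (LinearMap.exact_iff.1 (hF.exact_succ i)).symm
  have hz : σ • y ∈ LinearMap.range (d (i + 1)) := by
    rw [hker, LinearMap.mem_ker, map_smul]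
    -- The entries of `d i` lie in `𝔪`, which `σ` annihilates.
    have hle : maximalIdeal R • (⊤ : Submodule R (F i)) ≤ LinearMap.ker (LinearMap.lsmul R _ σ) :=
      Submodule.smul_le.2 fun r hr v _ => by
        simp [smul_smul, hσ r hr]
    exact hle (hF.minimal i ⟨y, rfl⟩)
  refine ⟨i, isDirectSummand_of_socle (z := ⟨σ • y, hz⟩) (fun r hr => ?_) fun hmem => hy ?_⟩
  · ext
    simp [smul_smul, hσ r hr]
  · have h1 := Submodule.mem_map_of_mem (f := (LinearMap.range (d (i + 1))).subtype) hmem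
    rw [Submodule.map_smul'', Submodule.map_top, Submodule.range_subtype] at h1
    exact hker ▸ h1

end Burch

/-- The differential `d i : F (i + 1) → F i` is `∂_{i+1}`, so that its image is the syzygy
`Ω^{i+1} M`. -/
theorem mainTheorem2 {R : Type u} [CommRing R] [IsLocalRing R] [IsNoetherianRing R]
    (hBurch : Burch.IsBurchRing R) (hdepth : Burch.depth R = 0) (hfield : ¬ IsField R)
    {M : Type v} [AddCommGroup M] [Module R M] [Module.Finite R M]
    {F : ℕ → Type w} [∀ i, AddCommGroup (F i)] [∀ i, Module R (F i)]
    [∀ i, Module.Free R (F i)] [∀ i, Module.Finite R (F i)]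
    (d : ∀ i, F (i + 1) →ₗ[R] F i) (ε : F 0 →ₗ[R] M)
    (hF : Burch.IsMinimalFreeResolution d ε) :
    ((⨆ i, Burch.entryIdeal (d i)) = IsLocalRing.maximalIdeal R ↔
      ∃ i, 2 ≤ i + 1 ∧
        Burch.IsDirectSummand R (IsLocalRing.ResidueField R) (LinearMap.range (d i))) ∧
    ((⨆ i, Burch.entryIdeal (d i)) = IsLocalRing.maximalIdeal R →
      ∃ i, 3 ≤ i + 1 ∧ Burch.entryIdeal (d i) = IsLocalRing.maximalIdeal R) := by
  have next : ∀ i, Burch.IsDirectSummand R (IsLocalRing.ResidueField R) (LinearMap.range (d i)) →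
      Burch.entryIdeal (d (i + 1)) = IsLocalRing.maximalIdeal R := fun i =>
    Burch.entryIdeal_eq_of_isDirectSummand (hF.exact_succ i) (hF.minimal (i + 1))
  refine ⟨⟨fun h => ?_, ?_⟩, fun h => ?_⟩
  · obtain ⟨i, hi⟩ := hF.exists_isDirectSummand hBurch hdepth hfield h
    exact ⟨i + 1, by omega, hi⟩
  · rintro ⟨i, -, hi⟩
    refine le_antisymm (iSup_le fun j => Burch.entryIdeal_le (hF.minimal j)) ?_
    rw [← next i hi]
    exact le_iSup (fun j => Burch.entryIdeal (d j)) (i + 1)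
  · obtain ⟨i, hi⟩ := hF.exists_isDirectSummand hBurch hdepth hfield h
    exact ⟨i + 1 + 1, by omega, next _ hi⟩
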